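/- Let $A,B,C$ be finite-dimensional quantum systems. For a state $\rho$ and a positive semidefinite operator $\sigma$ on $AB$ let $D(\rho\|\sigma)=\mathrm{Tr}\,\rho(\log_2\rho-\log_2\sigma)$ if $\operatorname{supp}\rho\subseteq\operatorname{supp}\sigma$, and $D(\rho\|\sigma)=+\infty$ otherwise. The Rains relative entropy of a state $\rho^{AB}$ is $$R(A;B)_\rho=\inf_{\sigma\in\mathrm{PPT}'}D(\rho\|\sigma),\qquad \mathrm{PPT}'=\{\sigma^{AB}:\ \sigma\ge 0,\ \|\sigma^{T_B}\|_1\le 1\},$$ where $T_B$ is the partial transpose on $B$ and $\|\cdot\|_1$ is the trace norm. For a state $\rho^{ABC}$ define the Rains relative entropy of assistance (with helper $C$) by $$R_A(\rho^{ABC})=\sup_{\{E_i\}}\sum_i p_i\,R(A;B)_{\sigma_i},\qquad p_i=\mathrm{Tr}(E_i^C\rho^{ABC}),\quad \sigma_i=\tfrac1{p_i}\mathrm{Tr}_C(E_i^C\rho^{ABC}),$$ where the supremum is over all POVMs $\{E_i\}$ on $C$ with finitely many outcomes (terms with $p_i=0$ count as $0$). Then $R_A$ takes finite real values and is a convex function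 on the set of states of $ABC$: for all states $\rho_1,\dots,\rho_m$ on $ABC$ and all $q_j\ge 0$ with $\sum_j q_j=1$, $$R_A\Big(\sum_j q_j\rho_j\Big)\le\sum_j q_j\,R_A(\rho_j).$$ -/

import Mathlib

open scoped Kronecker MatrixOrder ComplexOrder

noncomputable section

namespace Quantum

variable {a b c d : Type*}

/-- The set of states (density matrices) of a finite-dimensional system whose Hilbert space has
an orthonormal basis indexed by `d`: positive semidefinite matrices of trace one. -/
def densityMatrices (d : Type*) [Fintype d] : Set (Matrix d d ℂ) :=
  {ρ | ρ.PosSemidef ∧ ρ.trace = 1}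

/-- The trace norm `‖X‖₁ = Tr |X| = Tr √(X† X)`. -/
def traceNorm [Fintype d] [DecidableEq d] (X : Matrix d d ℂ) : ℝ :=
  (CFC.abs X).trace.re

/-- The partial transpose `T_B` on the second tensor factor. -/
def partialTransposeRight (X : Matrix (a × b) (a × b) ℂ) : Matrix (a × b) (a × b) ℂ :=
  Matrix.of fun i j => X (i.1, j.2) (j.1, i.2)

/-- The partial trace over the second tensor factor. -/
def partialTraceRight [Fintype c] (X : Matrix (d × c) (d × c) ℂ) : Matrix d d ℂ :=
  Matrix.of fun i j => ∑ k, X (i, k) (j, k)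

open Classical in
/-- The quantum relative entropy `D(ρ‖σ) = Tr ρ (log ρ - log σ)` in bits (logarithm to base 2),
which is `+∞` unless the support of `ρ` lies in the support of `σ`, that is, `ker σ ⊆ ker ρ`.
The logarithms are taken by functional calculus with `log 0 = 0`, so that eigenvalues zero of `ρ`
contribute `0 log 0 = 0` and `log σ` is effectively taken on the support of `σ`. -/
def relativeEntropy [Fintype d] [DecidableEq d] (ρ σ : Matrix d d ℂ) : EReal :=
  if LinearMap.ker σ.mulVecLin ≤ LinearMap.ker ρ.mulVecLin then
    (((ρ * (cfc Real.log ρ - cfc Real.log σ)).trace.re / Real.log 2 : ℝ) : EReal)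
  else ⊤

/-- The Rains set `PPT' = {σ ≥ 0 : ‖σ^{T_B}‖₁ ≤ 1}`. -/
def rainsSet (a b : Type*) [Fintype a] [Fintype b] [DecidableEq a] [DecidableEq b] :
    Set (Matrix (a × b) (a × b) ℂ) :=
  {σ | σ.PosSemidef ∧ traceNorm (partialTransposeRight σ) ≤ 1}

/-- The Rains relative entropy `R(A;B)_ρ = inf_{σ ∈ PPT'} D(ρ‖σ)`. -/
def rainsRelativeEntropy [Fintype a] [Fintype b] [DecidableEq a] [DecidableEq b]
    (ρ : Matrix (a × b) (a × b) ℂ) : EReal :=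
  ⨅ σ ∈ rainsSet a b, relativeEntropy ρ σ

/-- A POVM with `n` outcomes: positive semidefinite operators that sum to the identity. -/
def IsPOVM [Fintype c] [DecidableEq c] {n : ℕ} (E : Fin n → Matrix c c ℂ) : Prop :=
  (∀ i, (E i).PosSemidef) ∧ ∑ i, E i = 1

/-- The probability `Tr (E^C ρ^{ABC})` of the outcome with effect `E` on `C`. -/
def outcomeProb [Fintype d] [Fintype c] [DecidableEq d]
    (E : Matrix c c ℂ) (ρ : Matrix (d × c) (d × c) ℂ) : ℝ :=
  (((1 : Matrix d d ℂ) ⊗ₖ E) * ρ).trace.re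

/-- The post-measurement state `(1 / p) Tr_C (E^C ρ^{ABC})`, where `p = Tr (E^C ρ^{ABC})`
(used only with weight `p`, hence irrelevant if `p = 0`). -/
def postState [Fintype d] [Fintype c] [DecidableEq d]
    (E : Matrix c c ℂ) (ρ : Matrix (d × c) (d × c) ℂ) : Matrix d d ℂ :=
  (outcomeProb E ρ)⁻¹ • partialTraceRight (((1 : Matrix d d ℂ) ⊗ₖ E) * ρ)

/-- The Rains relative entropy of assistance `R_A(ρ^{ABC})`: the supremum of
`∑ i, p_i R(A;B)_{σ_i}` over all POVMs on `C`. -/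
def rainsOfAssistance [Fintype a] [Fintype b] [Fintype c]
    [DecidableEq a] [DecidableEq b] [DecidableEq c]
    (ρ : Matrix ((a × b) × c) ((a × b) × c) ℂ) : EReal :=
  ⨆ (n : ℕ) (E : Fin n → Matrix c c ℂ) (_ : IsPOVM E),
    ∑ i, (outcomeProb (E i) ρ : EReal) * rainsRelativeEntropy (postState (E i) ρ)

end Quantum

end

noncomputable section

namespace Quantum

open Matrix

/-! For a fixed POVM each outcome contributes `p * R(τ)`, with `p` and `p • τ` linear in the state;
if `R` is convex, this contribution is convex too, being a perspective of `R`
(`outcomeProb_mul_postState_convex`). Sums over outcomes and suprema over POVMs preserve convexity,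
and the set of POVMs does not depend on the state. Finiteness follows from `0 ≤ R ≤ log₂ |AB|`.

Convexity of `R` is partial minimization of a jointly convex function over a convex set. The Rains
set is convex by the triangle inequality for the trace norm, so the analytic core is joint convexity
of `Tr ρ (log ρ - log σ)`.

That is proved through an integral formula. Up to the linear term `Tr (ρ - σ)`, the relative entropy
is the integral over `t ∈ (0,1)` of `(1 - t) ⟨ρ - σ, (t L_ρ + (1 - t) R_σ)⁻¹ (ρ - σ)⟩`, where `L_ρ`,
`R_σ` are left and right multiplication. Completing the square writes each integrand as a maximum
over matrices `W` of functionals linear in `(ρ, σ)`, hence as a jointly convex function. The two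
eigenbases diagonalize `L_ρ` and `R_σ` simultaneously and reduce everything to scalar identities
weighted by squared overlaps. -/

/-! ### Scalar integral formula for the relative entropy -/

/-- The integrand of the scalar formula
`x (log x - log y) - (x - y) = ∫ t in 0..1, (1 - t) * ((x - y) ^ 2 / (t * x + (1 - t) * y))`. -/
def entropyKernel (x y t : ℝ) : ℝ := (1 - t) * ((x - y) ^ 2 / (t * x + (1 - t) * y))

theorem entropyKernel_zero_left {y t : ℝ} (hy : 0 < y) (ht : t < 1) :
    entropyKernel 0 y t = y := by
  have : 1 - t ≠ 0 := by linarith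
  unfold entropyKernel
  field_simp
  ring

theorem entropyKernel_nonneg {x y t : ℝ} (hx : 0 ≤ x) (hy : 0 ≤ y) (ht : t ∈ Set.Ioo (0 : ℝ) 1) :
    0 ≤ entropyKernel x y t := by
  have h1 : 0 ≤ 1 - t := by linarith [ht.2]
  have h0 := ht.1.le
  unfold entropyKernel
  positivity

theorem intervalIntegrable_entropyKernel {x y : ℝ} (hx : 0 ≤ x) (hy : 0 < y) :
    IntervalIntegrable (entropyKernel x y) MeasureTheory.volume 0 1 := by
  rcases hx.eq_or_lt with rfl | hx
  · refine (intervalIntegrable_const (c := y)).congr_uIoo fun t ht => ?_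
    rw [Set.uIoo_of_le zero_le_one] at ht
    exact (entropyKernel_zero_left hy ht.2).symm
  · apply ContinuousOn.intervalIntegrable
    rw [Set.uIcc_of_le zero_le_one]
    unfold entropyKernel
    refine ContinuousOn.mul (by fun_prop) (ContinuousOn.div (by fun_prop) (by fun_prop) ?_)
    intro t ht
    have := convex_Ioi (0 : ℝ) hx hy ht.1 (sub_nonneg.2 ht.2) (by ring)
    simp only [smul_eq_mul, Set.mem_Ioi] at this
    exact this.ne'

theorem integral_entropyKernel {x y : ℝ} (hx : 0 ≤ x) (hy : 0 < y) :
    ∫ t in (0 : ℝ)..1, entropyKernel x y t = x * (Real.log x - Real.log y) - (x - y) := by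
  rcases hx.eq_or_lt with rfl | hx
  · rw [intervalIntegral.integral_congr_uIoo (g := fun _ => y)]
    · simp
    · intro t ht
      rw [Set.uIoo_of_le zero_le_one] at ht
      exact entropyKernel_zero_left hy ht.2
  · have hpos : ∀ t ∈ Set.uIcc (0 : ℝ) 1, 0 < t * x + (1 - t) * y := by
      intro t ht
      rw [Set.uIcc_of_le zero_le_one] at ht
      simpa using convex_Ioi (0 : ℝ) hx hy ht.1 (sub_nonneg.2 ht.2) (by ring)
    have hderiv : ∀ t ∈ Set.uIcc (0 : ℝ) 1, HasDerivAt
        (fun t => x * Real.log (t * x + (1 - t) * y) - t * (x - y)) (entropyKernel x y t) t := by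
      intro t ht
      have hp := hpos t ht
      have h1 : HasDerivAt (fun t : ℝ => t * x + (1 - t) * y) (x - y) t := by
        have := ((hasDerivAt_id t).mul_const x).add
          (((hasDerivAt_id t).const_sub 1).mul_const y)
        exact this.congr_deriv (by ring)
      have h2 := ((h1.log hp.ne').const_mul x).sub ((hasDerivAt_id t).mul_const (x - y))
      refine h2.congr_deriv ?_
      have := hp.ne'
      rw [entropyKernel, one_mul, ← mul_div_assoc, ← mul_div_assoc, div_sub' this,
        div_left_inj' this]
      ring
    rw [intervalIntegral.integral_eq_sub_of_hasDerivAt hderiv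
      (intervalIntegrable_entropyKernel hx.le hy)]
    simp
    ring

/-! ### Joint convexity of the quantum relative entropy -/

section RelativeEntropy

variable {d : Type*} [Fintype d]

/-- A sum of nonnegative quadratic forms vanishes only if each does, so a kernel vector of the
mixture is killed by every `σ` of nonzero weight. This keeps finiteness of the relative entropy
under mixing. -/
theorem ker_mulVecLin_add_smul_le {ρ₁ ρ₂ σ₁ σ₂ : Matrix d d ℂ} (hσ₁ : σ₁.PosSemidef)
    (hσ₂ : σ₂.PosSemidef) (h₁ : LinearMap.ker σ₁.mulVecLin ≤ LinearMap.ker ρ₁.mulVecLin)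
    (h₂ : LinearMap.ker σ₂.mulVecLin ≤ LinearMap.ker ρ₂.mulVecLin) {p q : ℝ} (hp : 0 ≤ p)
    (hq : 0 ≤ q) : LinearMap.ker (p • σ₁ + q • σ₂).mulVecLin ≤
      LinearMap.ker (p • ρ₁ + q • ρ₂).mulVecLin := by
  intro x hx
  simp only [LinearMap.mem_ker, mulVecLin_apply] at hx ⊢
  have hx' : star x ⬝ᵥ ((p • σ₁ + q • σ₂) *ᵥ x) = 0 := by rw [hx, dotProduct_zero]
  have n₁ := hσ₁.dotProduct_mulVec_nonneg x
  have n₂ := hσ₂.dotProduct_mulVec_nonneg x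
  rw [add_mulVec, smul_mulVec, smul_mulVec, dotProduct_add, dotProduct_smul, dotProduct_smul,
    add_eq_zero_iff_of_nonneg (smul_nonneg hp n₁) (smul_nonneg hq n₂), smul_eq_zero,
    smul_eq_zero, hσ₁.dotProduct_mulVec_zero_iff, hσ₂.dotProduct_mulVec_zero_iff] at hx'
  have k₁ : p • (ρ₁ *ᵥ x) = 0 := by
    rcases hx'.1 with h | h
    · rw [h, zero_smul]
    · have := h₁ (x := x) (by simpa using h)
      rw [show ρ₁ *ᵥ x = 0 by simpa using this, smul_zero]
  have k₂ : q • (ρ₂ *ᵥ x) = 0 := by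
    rcases hx'.2 with h | h
    · rw [h, zero_smul]
    · have := h₂ (x := x) (by simpa using h)
      rw [show ρ₂ *ᵥ x = 0 by simpa using this, smul_zero]
  rw [add_mulVec, smul_mulVec, smul_mulVec, k₁, k₂, add_zero]

variable [DecidableEq d] {ρ σ : Matrix d d ℂ}

/-- The matrix of inner products between the eigenbases of two Hermitian matrices. -/
def eigenOverlap (hρ : ρ.IsHermitian) (hσ : σ.IsHermitian) : Matrix d d ℂ :=
  star (hρ.eigenvectorUnitary : Matrix d d ℂ) * (hσ.eigenvectorUnitary : Matrix d d ℂ)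

/-- Expanding both factors in their own eigenbases turns a trace of noncommuting operators into a
scalar double sum with weights `|⟨u_i, v_j⟩|²`. Taking one of the functions to be `1` inserts the
other eigenbasis into a trace that does not involve it. -/
theorem trace_cfc_mul_cfc (hρ : ρ.IsHermitian) (hσ : σ.IsHermitian) (f g : ℝ → ℝ) :
    (cfc f ρ * cfc g σ).trace.re = ∑ i, ∑ j,
      Complex.normSq (eigenOverlap hρ hσ i j) * (f (hρ.eigenvalues i) * g (hσ.eigenvalues j)) := by
  rw [hρ.cfc_eq, hσ.cfc_eq, IsHermitian.cfc, IsHermitian.cfc, Unitary.conjStarAlgAut_apply,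
    Unitary.conjStarAlgAut_apply]
  set U := (hρ.eigenvectorUnitary : Matrix d d ℂ)
  set V := (hσ.eigenvectorUnitary : Matrix d d ℂ)
  have hK : star (eigenOverlap hρ hσ) = star V * U := by simp [eigenOverlap, U, V]
  have : (U * diagonal (RCLike.ofReal ∘ f ∘ hρ.eigenvalues) * star U *
      (V * diagonal (RCLike.ofReal ∘ g ∘ hσ.eigenvalues) * star V)).trace =
      (diagonal (RCLike.ofReal ∘ f ∘ hρ.eigenvalues) * eigenOverlap hρ hσ *
        (diagonal (RCLike.ofReal ∘ g ∘ hσ.eigenvalues) * star (eigenOverlap hρ hσ))).trace := by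
    rw [hK, eigenOverlap]
    simp only [Matrix.mul_assoc]
    rw [Matrix.trace_mul_comm]
    simp only [Matrix.mul_assoc]
    rfl
  rw [this, Matrix.trace]
  simp only [diag_apply, Matrix.mul_apply (M := _ * eigenOverlap hρ hσ), diagonal_mul, star_apply,
    Complex.re_sum]
  refine Finset.sum_congr rfl fun i _ => Finset.sum_congr rfl fun j _ => ?_
  simp [Complex.normSq_apply]
  ring

theorem eigenvectorUnitary_conj (hρ : ρ.IsHermitian) :
    ρ = (hρ.eigenvectorUnitary : Matrix d d ℂ) *
      diagonal (fun i => (hρ.eigenvalues i : ℂ)) *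
        star (hρ.eigenvectorUnitary : Matrix d d ℂ) := by
  conv_lhs => rw [hρ.spectral_theorem, Unitary.conjStarAlgAut_apply]
  rfl

theorem trace_sub_eq_sum (hρ : ρ.IsHermitian) (hσ : σ.IsHermitian) :
    (ρ - σ).trace.re = ∑ i, ∑ j, Complex.normSq (eigenOverlap hρ hσ i j) *
      (hρ.eigenvalues i - hσ.eigenvalues j) := by
  have h1 := trace_cfc_mul_cfc hρ hσ id (fun _ => 1)
  have h2 := trace_cfc_mul_cfc hρ hσ (fun _ => 1) id
  rw [cfc_id ℝ ρ hρ.isSelfAdjoint, cfc_const_one ℝ σ hσ.isSelfAdjoint, mul_one] at h1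
  rw [cfc_id ℝ σ hσ.isSelfAdjoint, cfc_const_one ℝ ρ hρ.isSelfAdjoint, one_mul] at h2
  rw [trace_sub, Complex.sub_re, h1, h2]
  simp only [← Finset.sum_sub_distrib]
  simp [mul_sub]

theorem trace_mul_log_sub_log (hρ : ρ.IsHermitian) (hσ : σ.IsHermitian) :
    (ρ * (cfc Real.log ρ - cfc Real.log σ)).trace.re =
      ∑ i, ∑ j, Complex.normSq (eigenOverlap hρ hσ i j) * (hρ.eigenvalues i *
        (Real.log (hρ.eigenvalues i) - Real.log (hσ.eigenvalues j))) := by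
  have h1 := trace_cfc_mul_cfc hρ hσ (fun x => x * Real.log x) (fun _ => 1)
  have h2 := trace_cfc_mul_cfc hρ hσ id Real.log
  have hcont (f : ℝ → ℝ) : ContinuousOn f (spectrum ℝ ρ) :=
    (finite_real_spectrum (A := ρ)).continuousOn f
  rw [cfc_mul _ _ ρ (hcont _) (hcont _), cfc_id' ℝ ρ hρ.isSelfAdjoint,
    cfc_const_one ℝ σ hσ.isSelfAdjoint, mul_one] at h1
  rw [cfc_id ℝ ρ hρ.isSelfAdjoint] at h2
  rw [mul_sub, trace_sub, Complex.sub_re, h1, h2]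
  simp only [← Finset.sum_sub_distrib]
  refine Finset.sum_congr rfl fun i _ => Finset.sum_congr rfl fun j _ => ?_
  simp only [id]
  ring

/-- A null vector of `σ` is a null vector of `ρ`, so `0 = ⟨u_i, ρ v_j⟩ = λ_i ⟨u_i, v_j⟩`. The
support condition thus enters the double sums termwise, exactly where `log 0` would matter. -/
theorem eigenOverlap_mul_eigenvalue_eq_zero (hρ : ρ.IsHermitian) (hσ : σ.IsHermitian)
    (hker : LinearMap.ker σ.mulVecLin ≤ LinearMap.ker ρ.mulVecLin) {i j : d}
    (hj : hσ.eigenvalues j = 0) : eigenOverlap hρ hσ i j = 0 ∨ hρ.eigenvalues i = 0 := by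
  set U := (hρ.eigenvectorUnitary : Matrix d d ℂ) with hU
  set V := (hσ.eigenvectorUnitary : Matrix d d ℂ) with hV
  have h1 : σ *ᵥ V.col j = 0 := by
    have := hσ.mulVec_eigenvectorBasis j
    rw [hj, zero_smul] at this
    simpa [hV, IsHermitian.eigenvectorUnitary_col_eq] using this
  have h2 : ρ *ᵥ V.col j = 0 := by
    have := hker (x := V.col j) (by simpa using h1)
    simpa using this
  have h3 : star U * (ρ * V) = diagonal (fun i => (hρ.eigenvalues i : ℂ)) *
      eigenOverlap hρ hσ := by
    conv_lhs => rw [eigenvectorUnitary_conj hρ]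
    simp only [← hU, eigenOverlap, ← hV, Matrix.mul_assoc]
    rw [← Matrix.mul_assoc (star U) U, hU, Unitary.coe_star_mul_self, Matrix.one_mul]
  have h4 : (star U * (ρ * V)) i j = 0 := by
    rw [Matrix.mul_apply]
    refine Finset.sum_eq_zero fun k _ => ?_
    have : (ρ * V) k j = (ρ *ᵥ V.col j) k := rfl
    rw [this, h2, Pi.zero_apply, mul_zero]
  rw [h3, diagonal_mul] at h4
  rcases mul_eq_zero.1 h4 with h | h
  · right; exact_mod_cast h
  · left; exact h

/-- The operator version of `entropyKernel`. -/
def entropyForm (hρ : ρ.IsHermitian) (hσ : σ.IsHermitian) (t : ℝ) : ℝ :=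
  ∑ i, ∑ j, Complex.normSq (eigenOverlap hρ hσ i j) *
    entropyKernel (hρ.eigenvalues i) (hσ.eigenvalues j) t

/-- When `σ` has eigenvalue `0`, either the weight vanishes or both eigenvalues do; then both sides
are `0` under the conventions `0 / 0 = 0` and `log 0 = 0`. Otherwise the scalar formula applies. -/
theorem weighted_entropyKernel (hρ : ρ.PosSemidef) (hσ : σ.PosSemidef)
    (hker : LinearMap.ker σ.mulVecLin ≤ LinearMap.ker ρ.mulVecLin) (i j : d) :
    IntervalIntegrable (fun t => Complex.normSq (eigenOverlap hρ.1 hσ.1 i j) *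
        entropyKernel (hρ.1.eigenvalues i) (hσ.1.eigenvalues j) t) MeasureTheory.volume 0 1 ∧
      ∫ t in (0 : ℝ)..1, Complex.normSq (eigenOverlap hρ.1 hσ.1 i j) *
        entropyKernel (hρ.1.eigenvalues i) (hσ.1.eigenvalues j) t =
      Complex.normSq (eigenOverlap hρ.1 hσ.1 i j) * (hρ.1.eigenvalues i *
        (Real.log (hρ.1.eigenvalues i) - Real.log (hσ.1.eigenvalues j)) -
          (hρ.1.eigenvalues i - hσ.1.eigenvalues j)) := by
  rcases (hσ.eigenvalues_nonneg j).eq_or_lt with hj | hj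
  · rcases eigenOverlap_mul_eigenvalue_eq_zero hρ.1 hσ.1 hker (i := i) hj.symm with h | h
    · simp [h]
    · simp [h, ← hj, entropyKernel]
  · refine ⟨(intervalIntegrable_entropyKernel (hρ.eigenvalues_nonneg i) hj).const_mul _, ?_⟩
    rw [intervalIntegral.integral_const_mul,
      integral_entropyKernel (hρ.eigenvalues_nonneg i) hj]

theorem intervalIntegrable_entropyForm (hρ : ρ.PosSemidef) (hσ : σ.PosSemidef)
    (hker : LinearMap.ker σ.mulVecLin ≤ LinearMap.ker ρ.mulVecLin) :
    IntervalIntegrable (entropyForm hρ.1 hσ.1) MeasureTheory.volume 0 1 := by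
  have := IntervalIntegrable.sum (μ := MeasureTheory.volume) (a := 0) (b := 1) Finset.univ
    (fun i _ => IntervalIntegrable.sum (μ := MeasureTheory.volume) (a := 0) (b := 1) Finset.univ
      (fun j _ => (weighted_entropyKernel hρ hσ hker i j).1))
  refine this.congr fun t _ => ?_
  simp [entropyForm]

/-- The relative entropy (in nats, up to a trace term) as an integral of `entropyForm`. -/
theorem trace_mul_log_sub_log_eq_integral (hρ : ρ.PosSemidef) (hσ : σ.PosSemidef)
    (hker : LinearMap.ker σ.mulVecLin ≤ LinearMap.ker ρ.mulVecLin) :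
    (ρ * (cfc Real.log ρ - cfc Real.log σ)).trace.re =
      (ρ - σ).trace.re + ∫ t in (0 : ℝ)..1, entropyForm hρ.1 hσ.1 t := by
  have hw := weighted_entropyKernel hρ hσ hker
  unfold entropyForm
  rw [intervalIntegral.integral_finsetSum]
  · simp_rw [fun i => intervalIntegral.integral_finsetSum (fun j (_ : j ∈ Finset.univ) =>
      (hw i j).1), (hw _ _).2]
    rw [trace_mul_log_sub_log hρ.1 hσ.1, trace_sub_eq_sum hρ.1 hσ.1]
    simp only [← Finset.sum_add_distrib]
    refine Finset.sum_congr rfl fun i _ => Finset.sum_congr rfl fun j _ => ?_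
    ring
  · intro i _
    have := IntervalIntegrable.sum (μ := MeasureTheory.volume) (a := 0) (b := 1) Finset.univ
      (fun j _ => (hw i j).1)
    refine this.congr fun t _ => ?_
    simp

/-- The functional, affine in `(ρ, σ)`, whose supremum over `W` is `entropyForm`. -/
def entropyFunctional (t : ℝ) (W ρ σ : Matrix d d ℂ) : ℝ :=
  (1 - t) * (2 * (star W * (ρ - σ)).trace.re - t * (star W * ρ * W).trace.re -
    (1 - t) * (W * σ * star W).trace.re)

/-- In the basis `u_i v_j†` the superoperator `t L_ρ + (1 - t) R_σ` is diagonal, so with `W = U Z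
V†` the quadratic functional splits into independent problems for the entries of `Z`. -/
theorem entropyFunctional_conj (hρ : ρ.IsHermitian) (hσ : σ.IsHermitian) (t : ℝ)
    (Z : Matrix d d ℂ) :
    entropyFunctional t ((hρ.eigenvectorUnitary : Matrix d d ℂ) * Z *
        star (hσ.eigenvectorUnitary : Matrix d d ℂ)) ρ σ =
      ∑ i, ∑ j, (1 - t) * (2 * (star (Z i j) * eigenOverlap hρ hσ i j).re *
          (hρ.eigenvalues i - hσ.eigenvalues j) -
        (t * hρ.eigenvalues i + (1 - t) * hσ.eigenvalues j) * Complex.normSq (Z i j)) := by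
  set U := (hρ.eigenvectorUnitary : Matrix d d ℂ) with hU
  set V := (hσ.eigenvectorUnitary : Matrix d d ℂ) with hV
  set Λ : Matrix d d ℂ := diagonal (fun i => (hρ.eigenvalues i : ℂ)) with hΛ
  set M : Matrix d d ℂ := diagonal (fun i => (hσ.eigenvalues i : ℂ)) with hM
  have hU1 : star U * U = 1 := Unitary.coe_star_mul_self _
  have hV1 : star V * V = 1 := Unitary.coe_star_mul_self _
  have hUU (X : Matrix d d ℂ) : star U * (U * X) = X := by
    rw [← Matrix.mul_assoc, hU1, Matrix.one_mul]
  have hVV (X : Matrix d d ℂ) : star V * (V * X) = X := by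
    rw [← Matrix.mul_assoc, hV1, Matrix.one_mul]
  have eρ : star U * ρ = Λ * star U := by
    conv_lhs => rw [eigenvectorUnitary_conj hρ]
    rw [Matrix.mul_assoc, hUU]
  have eσ : σ * V = V * M := by
    conv_lhs => rw [eigenvectorUnitary_conj hσ]
    rw [Matrix.mul_assoc, hV1, Matrix.mul_one]
  have eρ' (X : Matrix d d ℂ) : star U * (ρ * X) = Λ * (star U * X) := by
    rw [← Matrix.mul_assoc, eρ, Matrix.mul_assoc]
  have eσ' (X : Matrix d d ℂ) : σ * (V * X) = V * (M * X) := by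
    rw [← Matrix.mul_assoc, eσ, Matrix.mul_assoc]
  have t1 : (star (U * Z * star V) * ρ).trace = (star Z * (Λ * eigenOverlap hρ hσ)).trace := by
    simp only [star_mul, star_star, Matrix.mul_assoc, eρ]
    rw [Matrix.trace_mul_comm, eigenOverlap]
    simp only [Matrix.mul_assoc, ← hU, ← hV]
  have t2 : (star (U * Z * star V) * σ).trace = (star Z * (eigenOverlap hρ hσ * M)).trace := by
    rw [Matrix.trace_mul_comm]
    simp only [star_mul, star_star, eσ']
    rw [Matrix.trace_mul_comm, Matrix.mul_assoc, Matrix.trace_mul_comm, eigenOverlap]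
    simp only [Matrix.mul_assoc, ← hU, ← hV]
  have t3 : (star (U * Z * star V) * ρ * (U * Z * star V)).trace = (star Z * (Λ * Z)).trace := by
    simp only [star_mul, star_star, Matrix.mul_assoc, eρ', hUU]
    rw [Matrix.trace_mul_comm]
    simp only [Matrix.mul_assoc, hV1, Matrix.mul_one]
  have t4 : (U * Z * star V * σ * star (U * Z * star V)).trace = (star Z * (Z * M)).trace := by
    simp only [star_mul, star_star, Matrix.mul_assoc, eσ', hVV]
    rw [Matrix.trace_mul_comm]
    simp only [Matrix.mul_assoc, hU1, Matrix.mul_one]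
    rw [← Matrix.mul_assoc, Matrix.trace_mul_comm]
  rw [entropyFunctional, Matrix.mul_sub, trace_sub, t1, t2, t3, t4]
  have key (Y : Matrix d d ℂ) : (star Z * Y).trace.re = ∑ i, ∑ j, (star (Z i j) * Y i j).re := by
    rw [Matrix.trace]
    simp only [diag_apply, Matrix.mul_apply, star_apply, Complex.re_sum]
    exact Finset.sum_comm
  rw [Complex.sub_re, key, key, key, key]
  simp only [← Finset.sum_sub_distrib, Finset.mul_sum]
  refine Finset.sum_congr rfl fun i _ => Finset.sum_congr rfl fun j _ => ?_
  simp [hΛ, hM, Complex.normSq_apply]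
  exact Or.inl (by ring)

/-- Completing the square in `D z - δ k`; the degenerate case `D = 0` needs `δ = 0`, since otherwise
the left side is unbounded unless `k = 0`. -/
theorem quadratic_le {z k : ℂ} {δ D : ℝ} (hD : 0 ≤ D) (h0 : D = 0 → δ = 0) :
    2 * (star z * k).re * δ - D * Complex.normSq z ≤ Complex.normSq k * (δ ^ 2 / D) := by
  rcases hD.eq_or_lt with h | h
  · simp [h0 h.symm, ← h]
  · rw [← mul_div_assoc, le_div_iff₀ h]
    simp only [Complex.star_def, Complex.mul_re, Complex.conj_re, Complex.conj_im,
      Complex.normSq_apply]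
    nlinarith [sq_nonneg (D * z.re - k.re * δ), sq_nonneg (D * z.im - k.im * δ)]

theorem sub_eq_zero_of_convex_comb_eq_zero {x y t : ℝ} (hx : 0 ≤ x) (hy : 0 ≤ y)
    (ht : t ∈ Set.Ioo (0 : ℝ) 1) (h : t * x + (1 - t) * y = 0) : x - y = 0 := by
  have h1 : 0 < 1 - t := by linarith [ht.2]
  have h2 := mul_nonneg ht.1.le hx
  have h3 := mul_nonneg h1.le hy
  have h4 : t * x = 0 := by linarith
  have h5 : (1 - t) * y = 0 := by linarith
  rw [(mul_eq_zero.1 h4).resolve_left ht.1.ne', (mul_eq_zero.1 h5).resolve_left h1.ne', sub_zero]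

theorem entropyFunctional_le_entropyForm (hρ : ρ.PosSemidef) (hσ : σ.PosSemidef) {t : ℝ}
    (ht : t ∈ Set.Ioo (0 : ℝ) 1) (W : Matrix d d ℂ) :
    entropyFunctional t W ρ σ ≤ entropyForm hρ.1 hσ.1 t := by
  have h1 : 0 ≤ 1 - t := by linarith [ht.2]
  set U := (hρ.1.eigenvectorUnitary : Matrix d d ℂ) with hU
  set V := (hσ.1.eigenvectorUnitary : Matrix d d ℂ) with hV
  have hW : W = U * (star U * W * V) * star V := by
    have hU1 : U * star U = 1 := Unitary.coe_mul_star_self _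
    have hV1 : V * star V = 1 := Unitary.coe_mul_star_self _
    simp only [Matrix.mul_assoc, hV1, Matrix.mul_one]
    rw [← Matrix.mul_assoc, hU1, Matrix.one_mul]
  rw [hW, entropyFunctional_conj hρ.1 hσ.1, entropyForm]
  refine Finset.sum_le_sum fun i _ => Finset.sum_le_sum fun j _ => ?_
  rw [entropyKernel, mul_left_comm]
  refine mul_le_mul_of_nonneg_left (quadratic_le ?_ ?_) h1
  · have := hρ.eigenvalues_nonneg i
    have := hσ.eigenvalues_nonneg j
    have := ht.1
    positivity
  · exact sub_eq_zero_of_convex_comb_eq_zero (hρ.eigenvalues_nonneg i)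
      (hσ.eigenvalues_nonneg j) ht

theorem exists_entropyFunctional_eq (hρ : ρ.PosSemidef) (hσ : σ.PosSemidef) {t : ℝ}
    (ht : t ∈ Set.Ioo (0 : ℝ) 1) :
    ∃ W, entropyFunctional t W ρ σ = entropyForm hρ.1 hσ.1 t := by
  -- The maximizer is the critical point of each entrywise quadratic, `z = k δ / D`. If `D = 0` then
  -- `δ = 0`, and the default value `z = 0` is as good as any.
  refine ⟨_ * (Matrix.of fun i j => eigenOverlap hρ.1 hσ.1 i j *
    (((hρ.1.eigenvalues i - hσ.1.eigenvalues j) /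
      (t * hρ.1.eigenvalues i + (1 - t) * hσ.1.eigenvalues j) : ℝ) : ℂ)) * _,
    (entropyFunctional_conj hρ.1 hσ.1 t _).trans ?_⟩
  refine Finset.sum_congr rfl fun i _ => Finset.sum_congr rfl fun j _ => ?_
  rw [entropyKernel, mul_left_comm]
  congr 1
  rw [Matrix.of_apply]
  generalize eigenOverlap hρ.1 hσ.1 i j = k
  have h0 := sub_eq_zero_of_convex_comb_eq_zero (hρ.eigenvalues_nonneg i)
    (hσ.eigenvalues_nonneg j) ht
  generalize hδ : hρ.1.eigenvalues i - hσ.1.eigenvalues j = δ at *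
  generalize t * hρ.1.eigenvalues i + (1 - t) * hσ.1.eigenvalues j = D at *
  by_cases hD : D = 0
  · simp [h0 hD, hD]
  · simp [Complex.normSq_apply]
    field_simp
    ring

theorem entropyForm_nonneg (hρ : ρ.PosSemidef) (hσ : σ.PosSemidef) {t : ℝ}
    (ht : t ∈ Set.Ioo (0 : ℝ) 1) : 0 ≤ entropyForm hρ.1 hσ.1 t :=
  Finset.sum_nonneg fun i _ => Finset.sum_nonneg fun j _ => mul_nonneg (Complex.normSq_nonneg _)
    (entropyKernel_nonneg (hρ.eigenvalues_nonneg i) (hσ.eigenvalues_nonneg j) ht)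

/-- Klein's inequality: the integrand of the remainder is nonnegative. -/
theorem trace_re_sub_le_trace_mul_log_sub_log (hρ : ρ.PosSemidef) (hσ : σ.PosSemidef)
    (hker : LinearMap.ker σ.mulVecLin ≤ LinearMap.ker ρ.mulVecLin) :
    (ρ - σ).trace.re ≤ (ρ * (cfc Real.log ρ - cfc Real.log σ)).trace.re := by
  rw [trace_mul_log_sub_log_eq_integral hρ hσ hker, le_add_iff_nonneg_right]
  have := intervalIntegral.integral_mono_on_of_le_Ioo (μ := MeasureTheory.volume)
    (f := fun _ => (0 : ℝ)) zero_le_one intervalIntegrable_const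
    (intervalIntegrable_entropyForm hρ hσ hker) fun t ht => entropyForm_nonneg hρ hσ ht
  simpa using this

theorem entropyFunctional_add_smul (t p q : ℝ) (W ρ₁ ρ₂ σ₁ σ₂ : Matrix d d ℂ) :
    entropyFunctional t W (p • ρ₁ + q • ρ₂) (p • σ₁ + q • σ₂) =
      p * entropyFunctional t W ρ₁ σ₁ + q * entropyFunctional t W ρ₂ σ₂ := by
  simp only [entropyFunctional, mul_sub, mul_add, add_mul, trace_add, trace_sub, Matrix.mul_smul,
    Matrix.smul_mul, trace_smul, Complex.add_re, Complex.sub_re, Complex.smul_re, smul_eq_mul]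
  ring

/-- **Joint convexity of the quantum relative entropy**. -/
theorem trace_mul_log_sub_log_jointly_convex {ρ₁ ρ₂ σ₁ σ₂ : Matrix d d ℂ} (hρ₁ : ρ₁.PosSemidef)
    (hρ₂ : ρ₂.PosSemidef) (hσ₁ : σ₁.PosSemidef) (hσ₂ : σ₂.PosSemidef)
    (h₁ : LinearMap.ker σ₁.mulVecLin ≤ LinearMap.ker ρ₁.mulVecLin)
    (h₂ : LinearMap.ker σ₂.mulVecLin ≤ LinearMap.ker ρ₂.mulVecLin) {p q : ℝ} (hp : 0 ≤ p)
    (hq : 0 ≤ q) :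
    ((p • ρ₁ + q • ρ₂) *
        (cfc Real.log (p • ρ₁ + q • ρ₂) - cfc Real.log (p • σ₁ + q • σ₂))).trace.re ≤
      p * (ρ₁ * (cfc Real.log ρ₁ - cfc Real.log σ₁)).trace.re +
        q * (ρ₂ * (cfc Real.log ρ₂ - cfc Real.log σ₂)).trace.re := by
  have hρ : (p • ρ₁ + q • ρ₂).PosSemidef := (hρ₁.smul hp).add (hρ₂.smul hq)
  have hσ : (p • σ₁ + q • σ₂).PosSemidef := (hσ₁.smul hp).add (hσ₂.smul hq)
  have hker := ker_mulVecLin_add_smul_le hσ₁ hσ₂ h₁ h₂ hp hq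
  rw [trace_mul_log_sub_log_eq_integral hρ hσ hker, trace_mul_log_sub_log_eq_integral hρ₁ hσ₁ h₁,
    trace_mul_log_sub_log_eq_integral hρ₂ hσ₂ h₂]
  have i₁ := intervalIntegrable_entropyForm hρ₁ hσ₁ h₁
  have i₂ := intervalIntegrable_entropyForm hρ₂ hσ₂ h₂
  have hint : ∫ t in (0 : ℝ)..1, entropyForm hρ.1 hσ.1 t ≤ ∫ t in (0 : ℝ)..1,
      (p * entropyForm hρ₁.1 hσ₁.1 t + q * entropyForm hρ₂.1 hσ₂.1 t) := by
    refine intervalIntegral.integral_mono_on_of_le_Ioo zero_le_one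
      (intervalIntegrable_entropyForm hρ hσ hker) ((i₁.const_mul p).add (i₂.const_mul q))
      fun t ht => ?_
    -- The `W` optimal for the mixture is a competitor for each component, and the functional is
    -- linear in `(ρ, σ)` for fixed `W`.
    obtain ⟨W, hW⟩ := exists_entropyFunctional_eq hρ hσ ht
    rw [← hW, entropyFunctional_add_smul]
    exact add_le_add
      (mul_le_mul_of_nonneg_left (entropyFunctional_le_entropyForm hρ₁ hσ₁ ht W) hp)
      (mul_le_mul_of_nonneg_left (entropyFunctional_le_entropyForm hρ₂ hσ₂ ht W) hq)
  rw [intervalIntegral.integral_add (i₁.const_mul p) (i₂.const_mul q),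
    intervalIntegral.integral_const_mul, intervalIntegral.integral_const_mul] at hint
  have htr : (p • ρ₁ + q • ρ₂ - (p • σ₁ + q • σ₂)).trace.re =
      p * (ρ₁ - σ₁).trace.re + q * (ρ₂ - σ₂).trace.re := by
    simp only [trace_add, trace_sub, trace_smul, Complex.add_re, Complex.sub_re, Complex.smul_re,
      smul_eq_mul]
    ring
  rw [htr]
  linarith

end RelativeEntropy

/-! ### Trace norm by duality with the sign operator -/

section TraceNorm

variable {d : Type*} [Fintype d] [DecidableEq d] {X Y : Matrix d d ℂ}

theorem abs_eq_cfc_abs (hX : X.IsHermitian) : CFC.abs X = cfc (fun x : ℝ => |x|) X :=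
  CFC.abs_eq_cfc_norm X hX.isSelfAdjoint

theorem traceNorm_eq_trace_sign_mul (hX : X.IsHermitian) :
    traceNorm X = (cfc (fun x : ℝ => (SignType.sign x : ℝ)) X * X).trace.re := by
  have hcont (f : ℝ → ℝ) : ContinuousOn f (spectrum ℝ X) :=
    (finite_real_spectrum (A := X)).continuousOn f
  have h : cfc (fun x : ℝ => |x|) X = cfc (fun x : ℝ => (SignType.sign x : ℝ)) X * X := by
    have := cfc_mul (fun x : ℝ => (SignType.sign x : ℝ)) (fun x => x) X (hcont _) (hcont _)
    rw [cfc_id' ℝ X hX.isSelfAdjoint] at this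
    simp only [← this, sign_mul_self]
  rw [traceNorm, abs_eq_cfc_abs hX, h]

/-- In the two eigenbases this is `± y ≤ |y|` and `0 ≤ |y|` termwise. Equality for `Y = X` makes the
norm a supremum of linear functionals, whence the triangle inequality; `X = 1` bounds the trace. -/
theorem trace_sign_mul_le_traceNorm (hX : X.IsHermitian) (hY : Y.IsHermitian) :
    (cfc (fun x : ℝ => (SignType.sign x : ℝ)) X * Y).trace.re ≤ traceNorm Y := by
  have h1 := trace_cfc_mul_cfc hX hY (fun x => (SignType.sign x : ℝ)) id
  have h2 := trace_cfc_mul_cfc hX hY (fun _ => 1) (fun x : ℝ => |x|)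
  rw [cfc_id ℝ Y hY.isSelfAdjoint] at h1
  rw [cfc_const_one ℝ X hX.isSelfAdjoint, one_mul] at h2
  rw [traceNorm, abs_eq_cfc_abs hY, h1, h2]
  refine Finset.sum_le_sum fun i _ => Finset.sum_le_sum fun j _ =>
    mul_le_mul_of_nonneg_left ?_ (Complex.normSq_nonneg _)
  rcases lt_trichotomy (hX.eigenvalues i) 0 with h | h | h
  · simp [sign_neg h, neg_le_abs]
  · simp [h]
  · simp [sign_pos h, le_abs_self]

theorem traceNorm_add_smul_le (hX : X.IsHermitian) (hY : Y.IsHermitian) {p q : ℝ} (hp : 0 ≤ p)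
    (hq : 0 ≤ q) : traceNorm (p • X + q • Y) ≤ p * traceNorm X + q * traceNorm Y := by
  have hZ : (p • X + q • Y).IsHermitian :=
    (hX.smul (IsSelfAdjoint.all p)).add (hY.smul (IsSelfAdjoint.all q))
  rw [traceNorm_eq_trace_sign_mul hZ, Matrix.mul_add, Matrix.mul_smul, Matrix.mul_smul, trace_add,
    trace_smul, trace_smul, Complex.add_re, Complex.smul_re, Complex.smul_re]
  exact add_le_add (mul_le_mul_of_nonneg_left (trace_sign_mul_le_traceNorm hZ hX) hp)
    (mul_le_mul_of_nonneg_left (trace_sign_mul_le_traceNorm hZ hY) hq)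

theorem trace_re_le_traceNorm (hX : X.IsHermitian) : X.trace.re ≤ traceNorm X := by
  have h := trace_sign_mul_le_traceNorm (X := (1 : Matrix d d ℂ)) isHermitian_one hX
  rwa [show cfc (fun x : ℝ => (SignType.sign x : ℝ)) (1 : Matrix d d ℂ) = 1 by
    simp, one_mul] at h

theorem traceNorm_of_posSemidef (hX : X.PosSemidef) : traceNorm X = X.trace.re := by
  rw [traceNorm, CFC.abs_of_nonneg X hX.nonneg]

end TraceNorm

/-! ### Convexity and bounds for the Rains relative entropy -/

section Rains

variable {a b : Type*}

theorem partialTransposeRight_add_smul (p q : ℝ) (X Y : Matrix (a × b) (a × b) ℂ) :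
    partialTransposeRight (p • X + q • Y) =
      p • partialTransposeRight X + q • partialTransposeRight Y := rfl

theorem isHermitian_partialTransposeRight {X : Matrix (a × b) (a × b) ℂ} (hX : X.IsHermitian) :
    (partialTransposeRight X).IsHermitian :=
  Matrix.IsHermitian.ext fun _ _ => hX.apply _ _

theorem trace_partialTransposeRight [Fintype a] [Fintype b] (X : Matrix (a × b) (a × b) ℂ) :
    (partialTransposeRight X).trace = X.trace := rfl

theorem partialTransposeRight_smul_one [DecidableEq a] [DecidableEq b] (r : ℝ) :
    partialTransposeRight (r • (1 : Matrix (a × b) (a × b) ℂ)) = r • 1 := by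
  ext ⟨i, j⟩ ⟨k, l⟩
  simp [partialTransposeRight, Matrix.one_apply, eq_comm]

variable [Fintype a] [Fintype b] [DecidableEq a] [DecidableEq b]

theorem convex_rainsSet : Convex ℝ (rainsSet a b) := by
  intro σ₁ h₁ σ₂ h₂ p q hp hq hpq
  refine ⟨(h₁.1.smul hp).add (h₂.1.smul hq), ?_⟩
  rw [partialTransposeRight_add_smul]
  refine (traceNorm_add_smul_le (isHermitian_partialTransposeRight h₁.1.1)
    (isHermitian_partialTransposeRight h₂.1.1) hp hq).trans ?_
  have e₁ := mul_le_mul_of_nonneg_left h₁.2 hp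
  have e₂ := mul_le_mul_of_nonneg_left h₂.2 hq
  linarith

theorem trace_re_le_one_of_mem_rainsSet {σ : Matrix (a × b) (a × b) ℂ} (hσ : σ ∈ rainsSet a b) :
    σ.trace.re ≤ 1 := by
  rw [← trace_partialTransposeRight]
  exact (trace_re_le_traceNorm (isHermitian_partialTransposeRight hσ.1.1)).trans hσ.2

theorem maximallyMixed_mem_rainsSet :
    ((Fintype.card (a × b) : ℝ)⁻¹ • (1 : Matrix (a × b) (a × b) ℂ)) ∈ rainsSet a b := by
  have h : ((Fintype.card (a × b) : ℝ)⁻¹ • (1 : Matrix (a × b) (a × b) ℂ)).PosSemidef :=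
    PosSemidef.one.smul (by positivity)
  refine ⟨h, ?_⟩
  rw [partialTransposeRight_smul_one, traceNorm_of_posSemidef h, trace_smul, trace_one,
    Complex.smul_re, Complex.natCast_re, smul_eq_mul]
  exact inv_mul_le_one

theorem eigenvalues_le_one {d : Type*} [Fintype d] [DecidableEq d] {ρ : Matrix d d ℂ}
    (hρ : ρ ∈ densityMatrices d) (i : d) : hρ.1.1.eigenvalues i ≤ 1 := by
  have h : ∑ i, hρ.1.1.eigenvalues i = 1 := by
    simpa using congrArg Complex.re (hρ.1.1.trace_eq_sum_eigenvalues.symm.trans hρ.2)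
  rw [← h]
  exact Finset.single_le_sum (fun i _ => hρ.1.eigenvalues_nonneg i) (Finset.mem_univ i)

theorem nonempty_of_mem_densityMatrices {d : Type*} [Fintype d] {ρ : Matrix d d ℂ}
    (hρ : ρ ∈ densityMatrices d) : Nonempty d := by
  by_contra h
  rw [not_nonempty_iff] at h
  have := hρ.2
  simp [Matrix.trace] at this

/-- Klein's inequality suffices because `Tr σ = Tr σ^{T_B} ≤ ‖σ^{T_B}‖₁ ≤ 1 = Tr ρ`. -/
theorem relativeEntropy_nonneg {ρ σ : Matrix (a × b) (a × b) ℂ}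
    (hρ : ρ ∈ densityMatrices (a × b)) (hσ : σ ∈ rainsSet a b) : 0 ≤ relativeEntropy ρ σ := by
  unfold relativeEntropy
  split_ifs with hker
  · have h1 := trace_re_sub_le_trace_mul_log_sub_log hρ.1 hσ.1 hker
    have h2 := trace_re_le_one_of_mem_rainsSet hσ
    rw [trace_sub, Complex.sub_re, hρ.2, Complex.one_re] at h1
    exact_mod_cast div_nonneg (by linarith) (Real.log_nonneg one_le_two)
  · exact le_top

/-- Here `log σ` is the scalar `-log |d|`, and `Tr ρ log ρ ≤ 0` because the eigenvalues of a state
lie in `[0, 1]`. -/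
theorem relativeEntropy_maximallyMixed_le {d : Type*} [Fintype d] [DecidableEq d]
    {ρ : Matrix d d ℂ} (hρ : ρ ∈ densityMatrices d) :
    relativeEntropy ρ ((Fintype.card d : ℝ)⁻¹ • (1 : Matrix d d ℂ)) ≤
      ((Real.log (Fintype.card d) / Real.log 2 : ℝ) : EReal) := by
  have := nonempty_of_mem_densityMatrices hρ
  have hN : (Fintype.card d : ℝ)⁻¹ ≠ 0 := by positivity
  have hker : LinearMap.ker ((Fintype.card d : ℝ)⁻¹ • (1 : Matrix d d ℂ)).mulVecLin ≤
      LinearMap.ker ρ.mulVecLin := by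
    intro x hx
    have : x = 0 := by simpa [smul_mulVec, hN] using hx
    simp [this]
  rw [relativeEntropy, if_pos hker, EReal.coe_le_coe_iff]
  refine div_le_div_of_nonneg_right ?_ (Real.log_nonneg one_le_two)
  have h1 : cfc Real.log ((Fintype.card d : ℝ)⁻¹ • (1 : Matrix d d ℂ)) =
      (-Real.log (Fintype.card d)) • 1 := by
    have := cfc_algebraMap (A := Matrix d d ℂ) (Fintype.card d : ℝ)⁻¹ Real.log
    rwa [Algebra.algebraMap_eq_smul_one, Algebra.algebraMap_eq_smul_one, Real.log_inv] at this
  have hcont (f : ℝ → ℝ) : ContinuousOn f (spectrum ℝ ρ) :=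
    (finite_real_spectrum (A := ρ)).continuousOn f
  have h2 : (ρ * cfc Real.log ρ).trace.re ≤ 0 := by
    have h := trace_cfc_mul_cfc hρ.1.1 hρ.1.1 (fun x => x * Real.log x) (fun _ => 1)
    rw [cfc_mul _ _ ρ (hcont _) (hcont _), cfc_id' ℝ ρ hρ.1.1.isSelfAdjoint,
      cfc_const_one ℝ ρ hρ.1.1.isSelfAdjoint, mul_one] at h
    rw [h]
    refine Finset.sum_nonpos fun i _ => Finset.sum_nonpos fun j _ =>
      mul_nonpos_of_nonneg_of_nonpos (Complex.normSq_nonneg _) ?_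
    rw [mul_one]
    exact mul_nonpos_of_nonneg_of_nonpos (hρ.1.eigenvalues_nonneg i)
      (Real.log_nonpos (hρ.1.eigenvalues_nonneg i) (eigenvalues_le_one hρ i))
  rw [h1, Matrix.mul_sub, trace_sub, Complex.sub_re, Matrix.mul_smul, Matrix.mul_one, trace_smul,
    hρ.2, Complex.smul_re, Complex.one_re, smul_eq_mul]
  linarith

theorem rainsRelativeEntropy_nonneg {ρ : Matrix (a × b) (a × b) ℂ}
    (hρ : ρ ∈ densityMatrices (a × b)) : 0 ≤ rainsRelativeEntropy ρ :=
  le_iInf₂ fun _ hσ => relativeEntropy_nonneg hρ hσ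

theorem rainsRelativeEntropy_le {ρ : Matrix (a × b) (a × b) ℂ}
    (hρ : ρ ∈ densityMatrices (a × b)) : rainsRelativeEntropy ρ ≤
      ((Real.log (Fintype.card (a × b)) / Real.log 2 : ℝ) : EReal) :=
  (iInf₂_le _ maximallyMixed_mem_rainsSet).trans (relativeEntropy_maximallyMixed_le hρ)

theorem coe_toReal_rainsRelativeEntropy {ρ : Matrix (a × b) (a × b) ℂ}
    (hρ : ρ ∈ densityMatrices (a × b)) :
    ((rainsRelativeEntropy ρ).toReal : EReal) = rainsRelativeEntropy ρ :=
  EReal.coe_toReal ((rainsRelativeEntropy_le hρ).trans_lt (EReal.coe_lt_top _)).ne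
    ((EReal.bot_lt_zero).trans_le (rainsRelativeEntropy_nonneg hρ)).ne'

theorem relativeEntropy_jointly_convex {d : Type*} [Fintype d] [DecidableEq d]
    {ρ₁ ρ₂ σ₁ σ₂ : Matrix d d ℂ} (hρ₁ : ρ₁.PosSemidef) (hρ₂ : ρ₂.PosSemidef)
    (hσ₁ : σ₁.PosSemidef) (hσ₂ : σ₂.PosSemidef) {x₁ x₂ p q : ℝ} (hp : 0 ≤ p) (hq : 0 ≤ q)
    (h₁ : relativeEntropy ρ₁ σ₁ < x₁) (h₂ : relativeEntropy ρ₂ σ₂ < x₂) :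
    relativeEntropy (p • ρ₁ + q • ρ₂) (p • σ₁ + q • σ₂) ≤ ((p * x₁ + q * x₂ : ℝ) : EReal) := by
  unfold relativeEntropy at h₁ h₂
  split_ifs at h₁ with k₁
  swap
  · exact absurd h₁ not_top_lt
  split_ifs at h₂ with k₂
  swap
  · exact absurd h₂ not_top_lt
  rw [EReal.coe_lt_coe_iff] at h₁ h₂
  rw [relativeEntropy, if_pos (ker_mulVecLin_add_smul_le hσ₁ hσ₂ k₁ k₂ hp hq),
    EReal.coe_le_coe_iff]
  calc _ ≤ (p * (ρ₁ * (cfc Real.log ρ₁ - cfc Real.log σ₁)).trace.re +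
        q * (ρ₂ * (cfc Real.log ρ₂ - cfc Real.log σ₂)).trace.re) / Real.log 2 :=
        div_le_div_of_nonneg_right
          (trace_mul_log_sub_log_jointly_convex hρ₁ hρ₂ hσ₁ hσ₂ k₁ k₂ hp hq)
          (Real.log_nonneg one_le_two)
    _ ≤ p * x₁ + q * x₂ := by
        rw [add_div, mul_div_assoc, mul_div_assoc]
        exact add_le_add (mul_le_mul_of_nonneg_left h₁.le hp) (mul_le_mul_of_nonneg_left h₂.le hq)

theorem convex_densityMatrices {d : Type*} [Fintype d] : Convex ℝ (densityMatrices d) := by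
  intro ρ₁ h₁ ρ₂ h₂ p q hp hq hpq
  refine ⟨(h₁.1.smul hp).add (h₂.1.smul hq), ?_⟩
  rw [trace_add, trace_smul, trace_smul, h₁.2, h₂.2, ← add_smul, hpq, one_smul]

theorem convexOn_rainsRelativeEntropy :
    ConvexOn ℝ (densityMatrices (a × b)) fun ρ => (rainsRelativeEntropy ρ).toReal := by
  refine ⟨convex_densityMatrices, fun ρ₁ h₁ ρ₂ h₂ p q hp hq hpq => ?_⟩
  -- Near-minimizers within `ε` avoid having to show that the infimum is attained; their mixture is
  -- feasible for the mixed state.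
  refine le_of_forall_pos_le_add fun ε hε => ?_
  have near {ρ : Matrix (a × b) (a × b) ℂ} (h : ρ ∈ densityMatrices (a × b)) :
      ∃ σ ∈ rainsSet a b, relativeEntropy ρ σ < ((rainsRelativeEntropy ρ).toReal + ε : ℝ) := by
    have : rainsRelativeEntropy ρ < ((rainsRelativeEntropy ρ).toReal + ε : ℝ) := by
      rw [← coe_toReal_rainsRelativeEntropy h, EReal.coe_lt_coe_iff, EReal.toReal_coe]
      linarith
    simpa [rainsRelativeEntropy, iInf_lt_iff] using this
  obtain ⟨σ₁, m₁, e₁⟩ := near h₁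
  obtain ⟨σ₂, m₂, e₂⟩ := near h₂
  have hle : rainsRelativeEntropy (p • ρ₁ + q • ρ₂) ≤ _ :=
    (iInf₂_le _ (convex_rainsSet m₁ m₂ hp hq hpq)).trans
      (relativeEntropy_jointly_convex h₁.1 h₂.1 m₁.1 m₂.1 hp hq e₁ e₂)
  rw [← coe_toReal_rainsRelativeEntropy (convex_densityMatrices h₁ h₂ hp hq hpq),
    EReal.coe_le_coe_iff] at hle
  refine hle.trans_eq ?_
  simp only [smul_eq_mul]
  linear_combination ε * hpq

end Rains

/-! ### Post-measurement operators on the remaining system -/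

section Measurement

variable {d c : Type*} [Fintype d] [Fintype c] [DecidableEq d]

/-- The unnormalized post-measurement operator `Tr_C (E^C ρ)`. -/
def measuredOperator (E : Matrix c c ℂ) (ρ : Matrix (d × c) (d × c) ℂ) : Matrix d d ℂ :=
  partialTraceRight (((1 : Matrix d d ℂ) ⊗ₖ E) * ρ)

theorem measuredOperator_apply (E : Matrix c c ℂ) (ρ : Matrix (d × c) (d × c) ℂ) (i j : d) :
    measuredOperator E ρ i j = ∑ k, ∑ l, E k l * ρ (i, l) (j, k) := by
  simp [measuredOperator, partialTraceRight, Matrix.mul_apply, Fintype.sum_prod_type,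
    Matrix.one_apply, ite_mul]

theorem outcomeProb_eq (E : Matrix c c ℂ) (ρ : Matrix (d × c) (d × c) ℂ) :
    outcomeProb E ρ = (measuredOperator E ρ).trace.re := by
  simp [outcomeProb, measuredOperator, partialTraceRight, Matrix.trace, Fintype.sum_prod_type]

theorem measuredOperator_add_smul (E : Matrix c c ℂ) (p q : ℝ)
    (ρ₁ ρ₂ : Matrix (d × c) (d × c) ℂ) :
    measuredOperator E (p • ρ₁ + q • ρ₂) =
      p • measuredOperator E ρ₁ + q • measuredOperator E ρ₂ := by
  ext i j
  simp [measuredOperator_apply, Finset.mul_sum, mul_add, Finset.sum_add_distrib, mul_left_comm]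

theorem posSemidef_measuredOperator [DecidableEq c] {E : Matrix c c ℂ} (hE : E.PosSemidef)
    {ρ : Matrix (d × c) (d × c) ℂ} (hρ : ρ.PosSemidef) : (measuredOperator E ρ).PosSemidef := by
  obtain ⟨B, hB⟩ := CStarAlgebra.nonneg_iff_eq_star_mul_self.1 hE.nonneg
  rw [star_eq_conjTranspose] at hB
  subst hB
  -- With `E = B† B`, the Kraus operators are `P m = 1 ⊗ ⟨m| B`, giving a manifestly positive form
  -- of `Tr_C (E ρ)`.
  let P (m : c) : Matrix d (d × c) ℂ := Matrix.of fun i x => if i = x.1 then B m x.2 else 0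
  have : measuredOperator (Bᴴ * B) ρ = ∑ m, P m * ρ * (P m)ᴴ := by
    ext i j
    simp only [measuredOperator_apply, Matrix.sum_apply, Matrix.mul_apply, conjTranspose_apply,
      Fintype.sum_prod_type, P, Matrix.of_apply, ite_mul, zero_mul, Finset.sum_mul, apply_ite star,
      star_zero, mul_ite, mul_zero, Finset.sum_ite_irrel, Finset.sum_const_zero, Finset.sum_ite_eq,
      Finset.mem_univ, if_true]
    rw [Finset.sum_congr rfl fun x _ => Finset.sum_comm, Finset.sum_comm]
    refine Finset.sum_congr rfl fun m _ => Finset.sum_congr rfl fun x _ =>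
      Finset.sum_congr rfl fun l _ => ?_
    ring
  rw [this]
  exact posSemidef_sum _ fun m _ => hρ.mul_mul_conjTranspose_same (P m)

theorem trace_measuredOperator [DecidableEq c] {E : Matrix c c ℂ} (hE : E.PosSemidef)
    {ρ : Matrix (d × c) (d × c) ℂ} (hρ : ρ.PosSemidef) :
    (measuredOperator E ρ).trace = (outcomeProb E ρ : ℂ) := by
  rw [outcomeProb_eq]
  exact Complex.ext rfl
    (Complex.nonneg_iff.1 (posSemidef_measuredOperator hE hρ).trace_nonneg).2.symm

theorem outcomeProb_nonneg [DecidableEq c] {E : Matrix c c ℂ} (hE : E.PosSemidef)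
    {ρ : Matrix (d × c) (d × c) ℂ} (hρ : ρ.PosSemidef) : 0 ≤ outcomeProb E ρ := by
  rw [outcomeProb_eq]
  exact (Complex.nonneg_iff.1 (posSemidef_measuredOperator hE hρ).trace_nonneg).1

theorem postState_mem_densityMatrices [DecidableEq c] {E : Matrix c c ℂ} (hE : E.PosSemidef)
    {ρ : Matrix (d × c) (d × c) ℂ} (hρ : ρ.PosSemidef) (h : outcomeProb E ρ ≠ 0) :
    postState E ρ ∈ densityMatrices d := by
  refine ⟨(posSemidef_measuredOperator hE hρ).smul
    (inv_nonneg.2 (outcomeProb_nonneg hE hρ)), ?_⟩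
  have : postState E ρ = (outcomeProb E ρ)⁻¹ • measuredOperator E ρ := rfl
  rw [this, trace_smul, trace_measuredOperator hE hρ, Complex.real_smul, ← Complex.ofReal_mul,
    inv_mul_cancel₀ h, Complex.ofReal_one]

/-- At probability zero `postState` is a default value, but a positive semidefinite operator of
trace zero vanishes, so the identity persists. -/
theorem measuredOperator_eq [DecidableEq c] {E : Matrix c c ℂ} (hE : E.PosSemidef)
    {ρ : Matrix (d × c) (d × c) ℂ} (hρ : ρ.PosSemidef) :
    measuredOperator E ρ = outcomeProb E ρ • postState E ρ := by
  by_cases h : outcomeProb E ρ = 0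
  · rw [h, zero_smul, ← (posSemidef_measuredOperator hE hρ).trace_eq_zero_iff,
      trace_measuredOperator hE hρ, h, Complex.ofReal_zero]
  · exact (smul_inv_smul₀ h _).symm

theorem outcomeProb_add_smul (E : Matrix c c ℂ) (p q : ℝ) (ρ₁ ρ₂ : Matrix (d × c) (d × c) ℂ) :
    outcomeProb E (p • ρ₁ + q • ρ₂) = p * outcomeProb E ρ₁ + q * outcomeProb E ρ₂ := by
  simp [outcomeProb_eq, measuredOperator_add_smul, trace_add, trace_smul]

theorem sum_outcomeProb [DecidableEq c] {n : ℕ} {E : Fin n → Matrix c c ℂ} (hE : IsPOVM E)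
    {ρ : Matrix (d × c) (d × c) ℂ} (hρ : ρ ∈ densityMatrices (d × c)) :
    ∑ i, outcomeProb (E i) ρ = 1 := by
  have h : (∑ i, ((1 : Matrix d d ℂ) ⊗ₖ E i) * ρ) = ρ := by
    rw [← Finset.sum_mul]
    have : ∑ i, ((1 : Matrix d d ℂ) ⊗ₖ E i) = (1 : Matrix d d ℂ) ⊗ₖ ∑ i, E i := by
      ext x y
      simp [Matrix.sum_apply, Finset.mul_sum]
    rw [this, hE.2, one_kronecker_one, one_mul]
  simp only [outcomeProb]
  rw [← Complex.re_sum, ← trace_sum, h, hρ.2, Complex.one_re]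

theorem isPOVM_one [DecidableEq c] : IsPOVM fun _ : Fin 1 => (1 : Matrix c c ℂ) :=
  ⟨fun _ => PosSemidef.one, by simp⟩

end Measurement

/-! ### Convexity of the assisted quantity -/

section Assistance

variable {a b c : Type*} [Fintype a] [Fintype b] [Fintype c] [DecidableEq a] [DecidableEq b]
  [DecidableEq c]

/-- A convex function on states, averaged over the outcomes of a measurement on the helper, is
convex: the contribution of a single outcome. -/
theorem outcomeProb_mul_postState_convex {d : Type*} [Fintype d] [DecidableEq d]
    {f : Matrix d d ℂ → ℝ} (hf : ConvexOn ℝ (densityMatrices d) f) {E : Matrix c c ℂ}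
    (hE : E.PosSemidef) {ρ₁ ρ₂ : Matrix (d × c) (d × c) ℂ} (h₁ : ρ₁.PosSemidef)
    (h₂ : ρ₂.PosSemidef) {p q : ℝ} (hp : 0 ≤ p) (hq : 0 ≤ q) :
    outcomeProb E (p • ρ₁ + q • ρ₂) * f (postState E (p • ρ₁ + q • ρ₂)) ≤
      p * (outcomeProb E ρ₁ * f (postState E ρ₁)) +
        q * (outcomeProb E ρ₂ * f (postState E ρ₂)) := by
  have hρ : (p • ρ₁ + q • ρ₂).PosSemidef := (h₁.smul hp).add (h₂.smul hq)
  have n₁ := mul_nonneg hp (outcomeProb_nonneg hE h₁)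
  have n₂ := mul_nonneg hq (outcomeProb_nonneg hE h₂)
  have hP := outcomeProb_add_smul E p q ρ₁ ρ₂
  rcases eq_or_ne (outcomeProb E (p • ρ₁ + q • ρ₂)) 0 with h0 | h0
  · have z₁ : p * outcomeProb E ρ₁ = 0 := by linarith
    have z₂ : q * outcomeProb E ρ₂ = 0 := by linarith
    rw [h0, ← mul_assoc, ← mul_assoc, z₁, z₂]
    simp
  have hτ := postState_mem_densityMatrices hE hρ h0
  -- A component of probability zero has no genuine post-measurement state, so convexity of `f`
  -- cannot be applied to it. The state of the mixture stands in for it, at weight zero.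
  have replace {ρ : Matrix (d × c) (d × c) ℂ} (h : ρ.PosSemidef) :
      ∃ τ ∈ densityMatrices d, measuredOperator E ρ = outcomeProb E ρ • τ ∧
        outcomeProb E ρ * f (postState E ρ) = outcomeProb E ρ * f τ := by
    by_cases hz : outcomeProb E ρ = 0
    · exact ⟨_, hτ, by rw [measuredOperator_eq hE h, hz, zero_smul, zero_smul], by simp [hz]⟩
    · exact ⟨_, postState_mem_densityMatrices hE h hz, measuredOperator_eq hE h, rfl⟩
  obtain ⟨τ₁, m₁, e₁, f₁⟩ := replace h₁
  obtain ⟨τ₂, m₂, e₂, f₂⟩ := replace h₂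
  set P := outcomeProb E (p • ρ₁ + q • ρ₂) with hPdef
  have hPpos : 0 < P := lt_of_le_of_ne (outcomeProb_nonneg hE hρ) h0.symm
  have hpost : postState E (p • ρ₁ + q • ρ₂) =
      (P⁻¹ * (p * outcomeProb E ρ₁)) • τ₁ + (P⁻¹ * (q * outcomeProb E ρ₂)) • τ₂ := by
    have : postState E (p • ρ₁ + q • ρ₂) = P⁻¹ • measuredOperator E (p • ρ₁ + q • ρ₂) := rfl
    rw [this, measuredOperator_add_smul, e₁, e₂, smul_add, smul_smul, smul_smul, smul_smul,
      smul_smul]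
    simp only [mul_assoc]
  have hconv := hf.2 m₁ m₂ (mul_nonneg (inv_nonneg.2 hPpos.le) n₁)
    (mul_nonneg (inv_nonneg.2 hPpos.le) n₂)
    (by rw [← mul_add, ← hP, inv_mul_cancel₀ h0])
  rw [← hpost] at hconv
  rw [f₁, f₂]
  refine (mul_le_mul_of_nonneg_left hconv hPpos.le).trans_eq ?_
  simp only [smul_eq_mul]
  field_simp

theorem coe_finset_sum_real {ι : Type*} (s : Finset ι) (f : ι → ℝ) :
    ((∑ i ∈ s, f i : ℝ) : EReal) = ∑ i ∈ s, (f i : EReal) := by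
  classical
  induction s using Finset.induction_on with
  | empty => simp
  | insert i s hi ih => rw [Finset.sum_insert hi, Finset.sum_insert hi, EReal.coe_add, ih]

/-- The average of the Rains relative entropy over the outcomes of a POVM is real. -/
theorem sum_outcomeProb_mul_rainsRelativeEntropy {n : ℕ} {E : Fin n → Matrix c c ℂ}
    (hE : IsPOVM E) {ρ : Matrix ((a × b) × c) ((a × b) × c) ℂ} (hρ : ρ.PosSemidef) :
    ∑ i, (outcomeProb (E i) ρ : EReal) * rainsRelativeEntropy (postState (E i) ρ) =
      ((∑ i, outcomeProb (E i) ρ * (rainsRelativeEntropy (postState (E i) ρ)).toReal : ℝ) :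
        EReal) := by
  rw [coe_finset_sum_real]
  refine Finset.sum_congr rfl fun i _ => ?_
  by_cases h : outcomeProb (E i) ρ = 0
  -- `0 * x = 0` in `EReal` even for infinite `x`, so the default `postState` is harmless.
  · simp [h]
  · rw [EReal.coe_mul, coe_toReal_rainsRelativeEntropy
      (postState_mem_densityMatrices (hE.1 i) hρ h)]

theorem le_rainsOfAssistance {n : ℕ} {E : Fin n → Matrix c c ℂ} (hE : IsPOVM E)
    {ρ : Matrix ((a × b) × c) ((a × b) × c) ℂ} (hρ : ρ.PosSemidef) :
    ((∑ i, outcomeProb (E i) ρ * (rainsRelativeEntropy (postState (E i) ρ)).toReal : ℝ) :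
      EReal) ≤ rainsOfAssistance ρ := by
  rw [← sum_outcomeProb_mul_rainsRelativeEntropy hE hρ]
  exact le_iSup₂_of_le n E (le_iSup_of_le hE le_rfl)

theorem rainsOfAssistance_le {ρ : Matrix ((a × b) × c) ((a × b) × c) ℂ}
    (hρ : ρ ∈ densityMatrices ((a × b) × c)) :
    rainsOfAssistance ρ ≤ ((Real.log (Fintype.card (a × b)) / Real.log 2 : ℝ) : EReal) := by
  refine iSup₂_le fun n E => iSup_le fun hE => ?_
  rw [sum_outcomeProb_mul_rainsRelativeEntropy hE hρ.1, EReal.coe_le_coe_iff]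
  calc _ ≤ ∑ i, outcomeProb (E i) ρ * (Real.log (Fintype.card (a × b)) / Real.log 2) := by
        refine Finset.sum_le_sum fun i _ => ?_
        by_cases h : outcomeProb (E i) ρ = 0
        · simp [h]
        · have hd := postState_mem_densityMatrices (hE.1 i) hρ.1 h
          refine mul_le_mul_of_nonneg_left ?_ (outcomeProb_nonneg (hE.1 i) hρ.1)
          rw [← EReal.coe_le_coe_iff, coe_toReal_rainsRelativeEntropy hd]
          exact rainsRelativeEntropy_le hd
    _ = _ := by rw [← Finset.sum_mul, sum_outcomeProb hE hρ, one_mul]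

theorem coe_toReal_rainsOfAssistance {ρ : Matrix ((a × b) × c) ((a × b) × c) ℂ}
    (hρ : ρ ∈ densityMatrices ((a × b) × c)) :
    ((rainsOfAssistance ρ).toReal : EReal) = rainsOfAssistance ρ :=
  EReal.coe_toReal ((rainsOfAssistance_le hρ).trans_lt (EReal.coe_lt_top _)).ne
    -- Any POVM gives a real lower bound; the trivial one shows that the supremum is not `⊥`.
    ((EReal.bot_lt_coe _).trans_le (le_rainsOfAssistance isPOVM_one hρ.1)).ne'

theorem convexOn_rainsOfAssistance :
    ConvexOn ℝ (densityMatrices ((a × b) × c)) fun ρ => (rainsOfAssistance ρ).toReal := by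
  refine ⟨convex_densityMatrices, fun ρ₁ h₁ ρ₂ h₂ p q hp hq hpq => ?_⟩
  have hρ := convex_densityMatrices h₁ h₂ hp hq hpq
  rw [← EReal.coe_le_coe_iff, coe_toReal_rainsOfAssistance hρ]
  refine iSup₂_le fun n E => iSup_le fun hE => ?_
  rw [sum_outcomeProb_mul_rainsRelativeEntropy hE hρ.1, EReal.coe_le_coe_iff]
  have bound {ρ : Matrix ((a × b) × c) ((a × b) × c) ℂ}
      (h : ρ ∈ densityMatrices ((a × b) × c)) :
      ∑ i, outcomeProb (E i) ρ * (rainsRelativeEntropy (postState (E i) ρ)).toReal ≤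
        (rainsOfAssistance ρ).toReal := by
    rw [← EReal.coe_le_coe_iff, coe_toReal_rainsOfAssistance h]
    exact le_rainsOfAssistance hE h.1
  calc _ ≤ ∑ i, (p * (outcomeProb (E i) ρ₁ *
            (rainsRelativeEntropy (postState (E i) ρ₁)).toReal) +
          q * (outcomeProb (E i) ρ₂ * (rainsRelativeEntropy (postState (E i) ρ₂)).toReal)) :=
        Finset.sum_le_sum fun i _ => outcomeProb_mul_postState_convex
          convexOn_rainsRelativeEntropy (hE.1 i) h₁.1 h₂.1 hp hq
    _ ≤ _ := by
        rw [Finset.sum_add_distrib, ← Finset.mul_sum, ← Finset.mul_sum]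
        exact add_le_add (mul_le_mul_of_nonneg_left (bound h₁) hp)
          (mul_le_mul_of_nonneg_left (bound h₂) hq)

end Assistance

end Quantum

end

theorem mainTheorem8 {a b c : Type*} [Fintype a] [Fintype b] [Fintype c]
    [DecidableEq a] [DecidableEq b] [DecidableEq c] :
    (∀ ρ ∈ Quantum.densityMatrices ((a × b) × c),
      ∃ r : ℝ, Quantum.rainsOfAssistance ρ = (r : EReal)) ∧
    ConvexOn ℝ (Quantum.densityMatrices ((a × b) × c))
      (fun ρ => (Quantum.rainsOfAssistance ρ).toReal) :=
  ⟨fun _ hρ => ⟨_, (Quantum.coe_toReal_rainsOfAssistance hρ).symm⟩,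
    Quantum.convexOn_rainsOfAssistance⟩
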